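/- Let $n,p,s$ be integers with $1\le s<p$, $p\ge 3$ and $s\le n/\log p$. Let $\mathcal X\subset\mathbb R^p$, $\mathcal Y\subset\mathbb R$ satisfy $\|\boldsymbol x\|_\infty\le b_x$ for all $\boldsymbol x\in\mathcal X$ and $|y|\le b_y$ for all $y\in\mathcal Y$, where $b_x,b_y>0$, and set $\mathcal Z=\mathcal X\times\mathcal Y$. Consider the linear model $\boldsymbol y=\boldsymbol X\boldsymbol\beta^*+\boldsymbol\epsilon$ with a fixed design $\boldsymbol X\in\mathbb R^{n\times p}$ whose rows lie in $\mathcal X$, with $y_i\in\mathcal Y$ almost surely for every $i$, with support $S^*=\{j:\beta^*_j\ne0\}$ of size $|S^*|=s$ and $\|\boldsymbol\beta^*\|_2\le M$ for some $M>0$, and with i.i.d. zero-mean noise $\epsilon_1,\dots,\epsilon_n$ that is sub-Gaussian with parameter $\sigma>0$, i.e. $\mathbb E e^{\lambda\epsilon_i}\le e^{\lambda^2\sigma^2/2}$ for all $\lambda\in\mathbb R$. Write $\mathcal D=(\boldsymbol X,\boldsymbol y)$ for the resulting dataset. Assume that there are $\kappa_-,\kappa_+>0$ with $$\kappa_-\le\lambda_{\min}(\boldsymbol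 X_S^\top\boldsymbol X_S/n)\le\lambda_{\max}(\boldsymbol X_S^\top\boldsymbol X_S/n)\le\kappa_+\qquad\text{for all }S\subset[p],\ |S|=s .$$ Let $\hat{\boldsymbol\Sigma}=\boldsymbol X^\top\boldsymbol X/n$, let $\hat{\boldsymbol\Sigma}_{A,B}$ be its block with rows in $A$ and columns in $B$, let $\hat{\boldsymbol D}(S)=\hat{\boldsymbol\Sigma}_{S^*\setminus S,S^*\setminus S}-\hat{\boldsymbol\Sigma}_{S^*\setminus S,S}\hat{\boldsymbol\Sigma}_{S,S}^{-1}\hat{\boldsymbol\Sigma}_{S,S^*\setminus S}$, and let the identifiability margin be $$\tau=\min_{|S|=s,\;S\ne S^*}\frac{\boldsymbol\beta^{*\top}_{S^*\setminus S}\hat{\boldsymbol D}(S)\boldsymbol\beta^*_{S^*\setminus S}}{|S^*\setminus S|}.$$ Let $r\ge\frac{\kappa_+}{\kappa_-}M+4\frac{\sigma b_x}{\kappa_-}$. For a dataset $\mathcal D'=(\boldsymbol X',\boldsymbol y')\in(\mathbb R^p\times\mathbb R)^n$ and a support $S\subset[p]$ with $|S|=s$ put $$\mathcal R(S,\mathcal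 D')=\min\{\|\boldsymbol y'-\boldsymbol X'_S\boldsymbol\beta\|_2^2:\boldsymbol\beta\in\mathbb R^{s},\ \|\boldsymbol\beta\|_2^2\le r^2\}.$$ Let $\hat S_1(\mathcal D')$ be a minimizer of $\mathcal R(\cdot,\mathcal D')$ over the supports of size $s$, and let $\hat S_2(\mathcal D')$ be a minimizer over the supports of size $s$ other than $\hat S_1(\mathcal D')$. Let $$\Delta=\sup\{\mathcal R(S,\mathcal D')-\mathcal R(S,\mathcal D''):|S|=s,\ \mathcal D',\mathcal D''\in\mathcal Z^n\text{ differing in at most one observation}\}$$ be the global sensitivity. Then there is a universal constant $c>0$ (independent of all the quantities above) such that, with $$c_0=\frac4c+b_y^2+b_x^2r^2,\qquad C=\max\Bigl\{8^2c_0,\ \frac{8^2c_0}{\sigma^2}\Bigr\}$$ (so that $C$ depends only on $b_x,b_y,r,\sigma$), whenever $$\tau\ge C\sigma^2\,\frac{s\log p}{n},$$ the sensitivity $\Delta$ is finite and $$\mathbb P\bigl(\mathcal R(\hat S_2(\mathcal D),\mathcal D)-\mathcal R(\hat S_1(\mathcal D),\mathcal D)>2\Delta\bigr)\ \ge\ 1-10\,s\,p^{-2}.$$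 The same bound on the probability holds with the explicit value $2b_y^2+2b_x^2r^2s$ in place of $\Delta$. -/

import Mathlib

open MeasureTheory ProbabilityTheory

namespace BSS

/-- A dataset with `n` observations `(x_i, y_i)`, where `x_i ∈ ℝ^p` is the `i`-th row of `X`. -/
structure Dataset (n p : ℕ) where
  X : Matrix (Fin n) (Fin p) ℝ
  y : Fin n → ℝ

/-- All observations of the dataset lie in the data space `𝒳 × 𝒴`. -/
def Dataset.MemSpace {n p : ℕ} (D : Dataset n p) (𝒳 : Set (Fin p → ℝ)) (𝒴 : Set ℝ) : Prop :=
  ∀ i, D.X i ∈ 𝒳 ∧ D.y i ∈ 𝒴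

/-- Neighbouring datasets: they agree except possibly in one observation. -/
def Neighbors {n p : ℕ} (D D' : Dataset n p) : Prop :=
  ∃ i, ∀ k, k ≠ i → D.X k = D'.X k ∧ D.y k = D'.y k

/-- The residual sum of squares `‖y - X_S β‖₂²`, for `β ∈ ℝ^S`. -/
def rss {n p : ℕ} (D : Dataset n p) (S : Finset (Fin p)) (β : S → ℝ) : ℝ :=
  ∑ i, (D.y i - ∑ j : S, D.X i j * β j) ^ 2

/-- The objective `R(S, D)`: the minimum of `‖y - X_S β‖₂²` over `β ∈ ℝ^S` with `‖β‖₂² ≤ r²`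
(an infimum of a continuous function over a nonempty compact set). -/
noncomputable def objective {n p : ℕ} (r : ℝ) (S : Finset (Fin p)) (D : Dataset n p) : ℝ :=
  sInf (rss D S '' {β | ∑ j, β j ^ 2 ≤ r ^ 2})

/-- `S₁, S₂` are the first two supports in an enumeration of the supports of size `s`
by increasing objective: `S₁` minimizes the objective over all supports of size `s`,
and `S₂` minimizes it over all supports of size `s` other than `S₁`. -/
def IsTopTwo {n p : ℕ} (r : ℝ) (s : ℕ) (D : Dataset n p) (S₁ S₂ : Finset (Fin p)) : Prop :=
  (S₁.card = s ∧ ∀ S : Finset (Fin p), S.card = s → objective r S₁ D ≤ objective r S D) ∧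
  (S₂.card = s ∧ S₂ ≠ S₁ ∧
    ∀ S : Finset (Fin p), S.card = s → S ≠ S₁ → objective r S₂ D ≤ objective r S D)

/-- All the values `R(S, D) - R(S, D')`, for supports `S` of size `s` and neighbouring datasets
`D, D'` with observations in `𝒳 × 𝒴`. -/
def sensitivitySet {p : ℕ} (n s : ℕ) (r : ℝ) (𝒳 : Set (Fin p → ℝ)) (𝒴 : Set ℝ) : Set ℝ :=
  {d | ∃ (S : Finset (Fin p)) (D D' : Dataset n p), S.card = s ∧ D.MemSpace 𝒳 𝒴 ∧
    D'.MemSpace 𝒳 𝒴 ∧ Neighbors D D' ∧ d = objective r S D - objective r S D'}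

/-- The global sensitivity `Δ` of the objective. -/
noncomputable def globalSensitivity {p : ℕ} (n s : ℕ) (r : ℝ) (𝒳 : Set (Fin p → ℝ))
    (𝒴 : Set ℝ) : ℝ :=
  sSup (sensitivitySet n s r 𝒳 𝒴)

/-- The support `S* = {j : β*_j ≠ 0}`. -/
noncomputable def trueSupport {p : ℕ} (β : Fin p → ℝ) : Finset (Fin p) :=
  {j | β j ≠ 0}

/-- The supports of size `s` making `t` mistakes with respect to `T`. -/
def mistakeSupports {p : ℕ} (s : ℕ) (T : Finset (Fin p)) (t : ℕ) : Set (Finset (Fin p)) :=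
  {S | S.card = s ∧ (S \ T).card = t}

/-- The sample covariance `n⁻¹ Xᵀ X`. -/
noncomputable def sampleCov {n p : ℕ} (X : Matrix (Fin n) (Fin p) ℝ) :
    Matrix (Fin p) (Fin p) ℝ :=
  (n : ℝ)⁻¹ • (X.transpose * X)

/-- The block of the sample covariance with rows in `A` and columns in `B`. -/
noncomputable def covBlock {n p : ℕ} (X : Matrix (Fin n) (Fin p) ℝ) (A B : Finset (Fin p)) :
    Matrix A B ℝ :=
  (sampleCov X).submatrix (fun j : A => (j : Fin p)) (fun j : B => (j : Fin p))

/-- The residual covariance of `X_{T \ S}` after regression on `X_S`. -/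
noncomputable def residCov {n p : ℕ} (X : Matrix (Fin n) (Fin p) ℝ) (T S : Finset (Fin p)) :
    Matrix ↥(T \ S) ↥(T \ S) ℝ :=
  covBlock X (T \ S) (T \ S) - covBlock X (T \ S) S * (covBlock X S S)⁻¹ * covBlock X S (T \ S)

/-- The discrimination margin of `S`, per mistake. -/
noncomputable def margin {n p : ℕ} (X : Matrix (Fin n) (Fin p) ℝ) (β : Fin p → ℝ)
    (S : Finset (Fin p)) : ℝ :=
  let b : ↥(trueSupport β \ S) → ℝ := fun j => β j
  dotProduct b ((residCov X (trueSupport β) S).mulVec b) / ((trueSupport β \ S).card : ℝ)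

/-- The identifiability margin `τ`: the minimum of the margin over the (finitely many) supports of
size `s` that make between `1` and `s` mistakes. -/
noncomputable def identMargin {n p : ℕ} (X : Matrix (Fin n) (Fin p) ℝ) (β : Fin p → ℝ)
    (s : ℕ) : ℝ :=
  sInf (margin X β '' ⋃ t ∈ Set.Icc 1 s, mistakeSupports s (trueSupport β) t)

/-- The sparse Riesz condition: for every support of size `s`, all eigenvalues of the symmetric
matrix `X_Sᵀ X_S / n` lie in `[κ₋, κ₊]`. -/
def SparseRiesz {n p : ℕ} (X : Matrix (Fin n) (Fin p) ℝ) (s : ℕ) (κm κp : ℝ) : Prop :=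
  ∀ S : Finset (Fin p), S.card = s → spectrum ℝ (covBlock X S S) ⊆ Set.Icc κm κp

/-- The dataset with design `X` and responses `y = X β + e`. -/
def linearData {n p : ℕ} (X : Matrix (Fin n) (Fin p) ℝ) (β : Fin p → ℝ) (e : Fin n → ℝ) :
    Dataset n p where
  X := X
  y := X.mulVec β + e

end BSS

/-!
Let `L = s log p`. The signal splits as `X β = X_S a + u_S` with `u_S` orthogonal to the columns of
`X_S`, and the Schur complement defining the margin is `‖u_S‖² / n` (`BSS.exists_residual`). So the
margin condition gives `‖u_S‖² ≥ 64 c₀ max(1, σ²) L` for every wrong support `S`.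

For coefficients `b` on `S` write `d = b - a`. The residual sum of squares is
`‖u_S‖² + 2 ⟨u_S, ε⟩ + ‖ε‖²` plus `‖X_S d‖² - 2 ⟨X_S d, ε⟩`. The last part is at least
`- s m² / (n κ₋)` once every column satisfies `|⟨X_j, ε⟩| ≤ m` (`BSS.le_rss_linearData`), so no tail
bound for quadratic forms of the noise is needed. With `m = 4 σ b_x √(n log p)` this loss is
`16 σ² b_x² L / κ₋ ≤ b_x² r² L ≤ c₀ L`, because `r ≥ 4 σ b_x / κ₋` and `κ₋ ≤ b_x²`.
On the other hand the true coefficients are feasible, since `κ₋ ≤ κ₊` and hence `M ≤ r`; so the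
objective at the true support is at most `‖ε‖²`.

The vectors `u_S` are deterministic, so Chernoff bounds for linear forms of the noise suffice: all
column correlations are below `m` up to probability `2 p⁻⁷`, and `⟨u_S, ε⟩ > -‖u_S‖ σ √(6 L)` for all
of the at most `p ^ s` wrong supports up to probability `p⁻²`. On this event every wrong support
exceeds the true one by at least `31 c₀ L`, which is larger than twice
`2 b_y² + 2 b_x² r² s`. That number bounds the sensitivity, because exchanging one observation changes
a single squared residual (`BSS.le_of_mem_sensitivitySet`). Hence the true support comes first and
the gap to the second one is large. The constants leave room for `c = 1`.
-/

namespace BSS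

open Matrix Finset

/-! ### Design blocks and the sparse Riesz condition -/

/-- The columns of the design indexed by `S`. -/
def colBlock {n p : ℕ} (X : Matrix (Fin n) (Fin p) ℝ) (S : Finset (Fin p)) :
    Matrix (Fin n) S ℝ :=
  X.submatrix id (fun j : S => (j : Fin p))

lemma covBlock_eq {n p : ℕ} (X : Matrix (Fin n) (Fin p) ℝ) (A B : Finset (Fin p)) :
    covBlock X A B = (n : ℝ)⁻¹ • ((colBlock X A)ᵀ * colBlock X B) := by
  ext i j
  simp [covBlock, sampleCov, colBlock, Matrix.mul_apply]

lemma rss_eq {n p : ℕ} (D : Dataset n p) (S : Finset (Fin p)) (b : S → ℝ) :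
    rss D S b = (D.y - colBlock D.X S *ᵥ b) ⬝ᵥ (D.y - colBlock D.X S *ᵥ b) := by
  simp [rss, dotProduct, mulVec, colBlock, sq]

lemma isHermitian_covBlock {n p : ℕ} (X : Matrix (Fin n) (Fin p) ℝ) (S : Finset (Fin p)) :
    (covBlock X S S).IsHermitian := by
  rw [covBlock_eq, Matrix.IsHermitian]
  simp [conjTranspose_eq_transpose_of_trivial, transpose_smul, transpose_mul]

/-- A lower bound for the spectrum of `X_Sᵀ X_S / n` bounds the quadratic form `‖X_S d‖²`. -/
lemma mul_dotProduct_le_of_spectrum {n p : ℕ} (hn : 0 < n) {X : Matrix (Fin n) (Fin p) ℝ}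
    {S : Finset (Fin p)} {κm κp : ℝ} (h : spectrum ℝ (covBlock X S S) ⊆ Set.Icc κm κp)
    (d : S → ℝ) :
    n * κm * (d ⬝ᵥ d) ≤ (colBlock X S *ᵥ d) ⬝ᵥ (colBlock X S *ᵥ d) := by
  classical
  have hn' : (0 : ℝ) < n := by exact_mod_cast hn
  set A := covBlock X S S with hA
  have hH : (A - algebraMap ℝ _ κm).IsHermitian := by
    refine (isHermitian_covBlock X S).sub ?_
    simp [Matrix.IsHermitian, algebraMap_eq_diagonal]
  have hpos : (A - algebraMap ℝ _ κm).PosSemidef := by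
    rw [hH.posSemidef_iff_eigenvalues_nonneg]
    intro i
    have hi := hH.eigenvalues_mem_spectrum_real i
    rw [← spectrum.sub_singleton_eq] at hi
    obtain ⟨x, hx, y, hy, hxy⟩ := hi
    have := (h hx).1
    rw [Set.mem_singleton_iff] at hy
    simp only [Pi.zero_apply]
    simp only at hxy
    linarith
  have hq := hpos.dotProduct_mulVec_nonneg d
  have e1 : A *ᵥ d = (n : ℝ)⁻¹ • ((colBlock X S)ᵀ *ᵥ (colBlock X S *ᵥ d)) := by
    rw [hA, covBlock_eq, smul_mulVec, mulVec_mulVec]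
  have e2 : (algebraMap ℝ (Matrix S S ℝ) κm) *ᵥ d = κm • d := by
    rw [Algebra.algebraMap_eq_smul_one, smul_mulVec, one_mulVec]
  have e3 : d ⬝ᵥ ((colBlock X S)ᵀ *ᵥ (colBlock X S *ᵥ d)) =
      (colBlock X S *ᵥ d) ⬝ᵥ (colBlock X S *ᵥ d) := by
    rw [dotProduct_mulVec, vecMul_transpose]
  rw [star_trivial, sub_mulVec, dotProduct_sub, e1, e2, dotProduct_smul, dotProduct_smul, e3,
    smul_eq_mul, smul_eq_mul, sub_nonneg] at hq
  calc n * κm * (d ⬝ᵥ d) = n * (κm * (d ⬝ᵥ d)) := by ring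
    _ ≤ n * ((n : ℝ)⁻¹ * _) := by gcongr
    _ = _ := by field_simp

lemma le_of_spectrum {n p : ℕ} {X : Matrix (Fin n) (Fin p) ℝ}
    {S : Finset (Fin p)} (hS : S.Nonempty) {κm κp : ℝ}
    (h : spectrum ℝ (covBlock X S S) ⊆ Set.Icc κm κp) : κm ≤ κp := by
  classical
  obtain ⟨j, hj⟩ := hS
  have := h ((isHermitian_covBlock X S).eigenvalues_mem_spectrum_real ⟨j, hj⟩)
  exact this.1.trans this.2

/-- The lower sparse Riesz constant is at most each diagonal entry of the sample covariance, hence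
at most the squared bound on the entries of the design. -/
lemma le_sq_of_spectrum {n p : ℕ} (hn : 0 < n) {X : Matrix (Fin n) (Fin p) ℝ} {b : ℝ}
    (hX : ∀ i j, |X i j| ≤ b)
    {S : Finset (Fin p)} (hS : S.Nonempty) {κm κp : ℝ}
    (h : spectrum ℝ (covBlock X S S) ⊆ Set.Icc κm κp) : κm ≤ b ^ 2 := by
  classical
  have hn' : (0 : ℝ) < n := by exact_mod_cast hn
  obtain ⟨j, hj⟩ := hS
  have := mul_dotProduct_le_of_spectrum hn h (Pi.single ⟨j, hj⟩ 1)
  rw [mulVec_single_one, single_one_dotProduct, Pi.single_eq_same, mul_one] at this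
  have h2 : (colBlock X S).col ⟨j, hj⟩ ⬝ᵥ (colBlock X S).col ⟨j, hj⟩ ≤ n * b ^ 2 := by
    calc _ = ∑ i, X i j ^ 2 := by simp [dotProduct, colBlock, sq]
      _ ≤ ∑ _i : Fin n, b ^ 2 := sum_le_sum fun i _ => sq_le_sq' (abs_le.1 (hX i j)).1
            (abs_le.1 (hX i j)).2
      _ = n * b ^ 2 := by simp
  exact le_of_mul_le_mul_left (this.trans h2) hn'

/-! ### The noiseless residual -/

lemma mulVec_eq_add {n p : ℕ} (X : Matrix (Fin n) (Fin p) ℝ) (β : Fin p → ℝ)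
    (S : Finset (Fin p)) :
    X *ᵥ β = colBlock X (trueSupport β \ S) *ᵥ (fun j => β j) +
      colBlock X S *ᵥ (fun j => β j) := by
  ext i
  simp only [mulVec, dotProduct, Pi.add_apply, colBlock, submatrix_apply, id]
  rw [sum_coe_sort (trueSupport β \ S) (fun j => X i j * β j),
    sum_coe_sort S (fun j => X i j * β j), ← sum_union sdiff_disjoint, sdiff_union_self_eq_union]
  refine (sum_subset (subset_univ _) fun j _ hj => ?_).symm
  have : β j = 0 := by
    by_contra h
    exact hj (mem_union_left _ (by simp [trueSupport, h]))
  simp [this]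

/-- Orthogonal decomposition of the signal along the columns of `X_S`. The squared norm of the
component `u` orthogonal to them is the Schur complement form which defines the margin. -/
lemma exists_residual {n p : ℕ} (hn : 0 < n) (X : Matrix (Fin n) (Fin p) ℝ) (β : Fin p → ℝ)
    {S : Finset (Fin p)} (hS : IsUnit (covBlock X S S).det) :
    ∃ (a : S → ℝ) (u : Fin n → ℝ), X *ᵥ β = colBlock X S *ᵥ a + u ∧
      (colBlock X S)ᵀ *ᵥ u = 0 ∧
      u ⬝ᵥ u = n * (margin X β S * (trueSupport β \ S).card) := by
  classical
  have hn' : (n : ℝ) ≠ 0 := by exact_mod_cast hn.ne'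
  set T := trueSupport β \ S with hT
  set b : T → ℝ := fun j => β j with hb
  set a : S → ℝ := (covBlock X S S)⁻¹ *ᵥ (covBlock X S T *ᵥ b) with ha
  set u : Fin n → ℝ := colBlock X T *ᵥ b - colBlock X S *ᵥ a with hu
  have hmul (A B : Finset (Fin p)) (v : B → ℝ) :
      (colBlock X A)ᵀ *ᵥ (colBlock X B *ᵥ v) = (n : ℝ) • (covBlock X A B *ᵥ v) := by
    rw [covBlock_eq, smul_mulVec, mulVec_mulVec, smul_smul, mul_inv_cancel₀ hn', one_smul]
  have horth : (colBlock X S)ᵀ *ᵥ u = 0 := by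
    rw [hu, mulVec_sub, hmul, hmul, ha, mulVec_mulVec (covBlock X S T *ᵥ b),
      Matrix.mul_nonsing_inv _ hS, one_mulVec, sub_self]
  refine ⟨(fun j : S => β j) + a, u, ?_, horth, ?_⟩
  · rw [mulVec_eq_add X β S, mulVec_add, hu]
    abel
  · have h1 : u ⬝ᵥ u = b ⬝ᵥ ((colBlock X T)ᵀ *ᵥ u) := by
      have h0 : (colBlock X S *ᵥ a) ⬝ᵥ u = 0 := by
        rw [dotProduct_comm, dotProduct_mulVec, ← mulVec_transpose, horth, zero_dotProduct]
      rw [dotProduct_mulVec b, vecMul_transpose]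
      nth_rewrite 1 [hu]
      rw [sub_dotProduct, h0, sub_zero]
    have h2 : (colBlock X T)ᵀ *ᵥ u = (n : ℝ) • (residCov X (trueSupport β) S *ᵥ b) := by
      rw [hu, mulVec_sub, hmul, hmul, ← smul_sub, residCov, sub_mulVec, ha, mulVec_mulVec,
        mulVec_mulVec, Matrix.mul_assoc]
    rw [h1, h2, dotProduct_smul, smul_eq_mul]
    congr 1
    rcases T.eq_empty_or_nonempty with h | h
    · have : IsEmpty T := by rw [h]; infer_instance
      simp [dotProduct, h]
    · have : (T.card : ℝ) ≠ 0 := by exact_mod_cast h.card_pos.ne'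
      simp only [margin]
      rw [div_mul_cancel₀ _ this]

lemma identMargin_le_margin {n p : ℕ} (X : Matrix (Fin n) (Fin p) ℝ) {β : Fin p → ℝ} {s : ℕ}
    {S : Finset (Fin p)} (hS : S.card = s) (hβ : (trueSupport β).card = s)
    (hne : S ≠ trueSupport β) : identMargin X β s ≤ margin X β S := by
  refine csInf_le (Set.Finite.bddBelow (Set.toFinite _)) ⟨S, ?_, rfl⟩
  simp only [Set.mem_iUnion]
  refine ⟨(S \ trueSupport β).card, ⟨?_, ?_⟩, hS, rfl⟩
  · rw [Nat.one_le_iff_ne_zero, Ne, card_eq_zero, sdiff_eq_empty_iff_subset]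
    exact fun h => hne (eq_of_subset_of_card_le h (hβ.trans hS.symm).le)
  · exact (card_le_card sdiff_subset).trans hS.le

/-! ### The objective and its sensitivity -/

lemma rss_nonneg {n p : ℕ} (D : Dataset n p) (S : Finset (Fin p)) (b : S → ℝ) :
    0 ≤ rss D S b := sum_nonneg fun _ _ => sq_nonneg _

lemma objective_le {n p : ℕ} {r : ℝ} (D : Dataset n p) (S : Finset (Fin p)) {b : S → ℝ}
    (hb : ∑ j, b j ^ 2 ≤ r ^ 2) : objective r S D ≤ rss D S b :=
  csInf_le ⟨0, by rintro _ ⟨b, _, rfl⟩; exact rss_nonneg D S b⟩ ⟨b, hb, rfl⟩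

lemma le_objective {n p : ℕ} {r a : ℝ} (D : Dataset n p) (S : Finset (Fin p))
    (h : ∀ b : S → ℝ, ∑ j, b j ^ 2 ≤ r ^ 2 → a ≤ rss D S b) : a ≤ objective r S D := by
  refine le_csInf (Set.Nonempty.image _ ⟨0, ?_⟩) ?_
  · simpa using sq_nonneg r
  · rintro _ ⟨b, hb, rfl⟩
    exact h b hb

/-- One squared residual is at most `2 b_y² + 2 b_x² r² s`, by the Cauchy-Schwarz inequality. -/
lemma sq_residual_le {n p : ℕ} {D : Dataset n p} {S : Finset (Fin p)} {b : S → ℝ} {r bx yb : ℝ}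
    (i : Fin n) (hx : ∀ j, |D.X i j| ≤ bx) (hy : |D.y i| ≤ yb) (hb : ∑ j, b j ^ 2 ≤ r ^ 2) :
    (D.y i - ∑ j : S, D.X i j * b j) ^ 2 ≤ 2 * yb ^ 2 + 2 * bx ^ 2 * r ^ 2 * S.card := by
  have h1 : (∑ j : S, D.X i j * b j) ^ 2 ≤ (S.card * bx ^ 2) * r ^ 2 := by
    refine (sum_mul_sq_le_sq_mul_sq _ _ _).trans (mul_le_mul ?_ hb ?_ (by positivity))
    · calc ∑ j : S, D.X i j ^ 2 ≤ ∑ _j : S, bx ^ 2 := sum_le_sum fun j _ =>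
            sq_le_sq' (abs_le.1 (hx j)).1 (abs_le.1 (hx j)).2
        _ = _ := by simp
    · exact sum_nonneg fun _ _ => sq_nonneg _
  have h2 : D.y i ^ 2 ≤ yb ^ 2 := sq_le_sq' (abs_le.1 hy).1 (abs_le.1 hy).2
  nlinarith [sq_nonneg (D.y i + ∑ j : S, D.X i j * b j)]

lemma le_of_mem_sensitivitySet {n p s : ℕ} {r bx yb : ℝ} {𝒳 : Set (Fin p → ℝ)} {𝒴 : Set ℝ}
    (hX : ∀ x ∈ 𝒳, ∀ j, |x j| ≤ bx) (hY : ∀ v ∈ 𝒴, |v| ≤ yb) {d : ℝ}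
    (hd : d ∈ sensitivitySet n s r 𝒳 𝒴) : d ≤ 2 * yb ^ 2 + 2 * bx ^ 2 * r ^ 2 * s := by
  obtain ⟨S, D, D', rfl, hD, -, ⟨i, hi⟩, rfl⟩ := hd
  rw [sub_le_comm]
  refine le_objective _ _ fun b hb => ?_
  have h1 := objective_le D S hb
  have h2 := sq_residual_le i (fun j => hX _ (hD i).1 j) (hY _ (hD i).2) hb
  have h3 : rss D S b - (D.y i - ∑ j : S, D.X i j * b j) ^ 2 ≤ rss D' S b := by
    rw [rss, rss, ← add_sum_erase _ _ (mem_univ i),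
      ← add_sum_erase _ (fun k => (D'.y k - ∑ j : S, D'.X k j * b j) ^ 2) (mem_univ i),
      add_sub_cancel_left]
    refine le_add_of_nonneg_of_le (sq_nonneg _) (sum_le_sum fun k hk => ?_)
    rw [(hi k (ne_of_mem_erase hk)).1, (hi k (ne_of_mem_erase hk)).2]
  linarith

/-! ### Deterministic bounds on the residual sums of squares -/

lemma sum_abs_sq_le {ι : Type*} [Fintype ι] (d : ι → ℝ) :
    (∑ j, |d j|) ^ 2 ≤ Fintype.card ι * (d ⬝ᵥ d) := by
  have := sq_sum_le_card_mul_sum_sq (s := univ) (f := fun j => |d j|)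
  simpa [sq_abs, dotProduct, sq] using this

/-- Lower bound for the residual sum of squares on `S`. Instead of the projection of the noise onto
the columns of `X_S`, only the correlations of the noise with single columns enter; they are
absorbed by the quadratic growth of `‖X_S d‖²`. -/
lemma le_rss_linearData {n p : ℕ} (hn : 0 < n) {X : Matrix (Fin n) (Fin p) ℝ} {β : Fin p → ℝ}
    {e : Fin n → ℝ} {S : Finset (Fin p)} {κm κp m : ℝ} (hκ : 0 < κm)
    (h : spectrum ℝ (covBlock X S S) ⊆ Set.Icc κm κp) {a : S → ℝ} {u : Fin n → ℝ}
    (hdec : X *ᵥ β = colBlock X S *ᵥ a + u) (horth : (colBlock X S)ᵀ *ᵥ u = 0)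
    (hm : ∀ j, |∑ i, X i j * e i| ≤ m) (b : S → ℝ) :
    u ⬝ᵥ u + 2 * (u ⬝ᵥ e) + e ⬝ᵥ e - S.card * m ^ 2 / (n * κm) ≤ rss (linearData X β e) S b := by
  have hn' : (0 : ℝ) < n := by exact_mod_cast hn
  set d := b - a with hd
  have hres : (linearData X β e).y - colBlock X S *ᵥ b = u + e - colBlock X S *ᵥ d := by
    simp only [linearData]
    rw [hdec, hd, mulVec_sub]
    abel
  have h0 : u ⬝ᵥ (colBlock X S *ᵥ d) = 0 := by
    rw [dotProduct_mulVec, ← mulVec_transpose, horth, zero_dotProduct]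
  have hexp : rss (linearData X β e) S b = u ⬝ᵥ u + 2 * (u ⬝ᵥ e) + e ⬝ᵥ e +
      ((colBlock X S *ᵥ d) ⬝ᵥ (colBlock X S *ᵥ d) - 2 * (e ⬝ᵥ (colBlock X S *ᵥ d))) := by
    rw [rss_eq, show (linearData X β e).X = X from rfl, hres]
    simp only [sub_dotProduct, add_dotProduct, dotProduct_sub, dotProduct_add]
    rw [dotProduct_comm (colBlock X S *ᵥ d) u, dotProduct_comm (colBlock X S *ᵥ d) e, h0,
      dotProduct_comm e u]
    ring
  have hcor : e ⬝ᵥ (colBlock X S *ᵥ d) ≤ (∑ j, |d j|) * m := by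
    rw [dotProduct_mulVec, dotProduct_comm, sum_mul]
    refine sum_le_sum fun j _ => ?_
    refine (le_abs_self _).trans ?_
    rw [abs_mul]
    refine mul_le_mul_of_nonneg_left ?_ (abs_nonneg _)
    have := hm j
    simpa [vecMul, dotProduct, colBlock, mul_comm] using this
  have hquad := mul_dotProduct_le_of_spectrum hn h d
  have hl1 := sum_abs_sq_le d
  rw [Fintype.card_coe] at hl1
  set x := ∑ j, |d j|
  set q := d ⬝ᵥ d
  set k : ℝ := n * κm
  have hk : 0 < k := by positivity
  -- Weighted arithmetic-geometric mean inequality, after `x² ≤ |S| q`.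
  have hfin : 2 * (x * m) ≤ k * q + S.card * m ^ 2 / k := by
    have hc : (0 : ℝ) ≤ S.card := by positivity
    have hq : 0 ≤ q := by
      simpa [q, dotProduct] using sum_nonneg fun j _ => mul_self_nonneg (d j)
    have h2 : (x * m) ^ 2 ≤ (k * q) * (S.card * m ^ 2 / k) := by
      have : (k * q) * (S.card * m ^ 2 / k) = (S.card * q) * m ^ 2 := by field_simp
      rw [this, mul_pow]
      gcongr
    have hA : 0 ≤ k * q := by positivity
    have hB : 0 ≤ S.card * m ^ 2 / k := by positivity
    refine le_of_abs_le (abs_le_of_sq_le_sq ?_ (by positivity))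
    nlinarith [sq_nonneg (k * q - S.card * m ^ 2 / k)]
  rw [hexp]
  linarith

lemma objective_trueSupport_le {n p : ℕ} (X : Matrix (Fin n) (Fin p) ℝ) {β : Fin p → ℝ}
    (e : Fin n → ℝ) {r : ℝ} (hβ : ∑ j, β j ^ 2 ≤ r ^ 2) :
    objective r (trueSupport β) (linearData X β e) ≤ e ⬝ᵥ e := by
  refine (objective_le _ _ (b := fun j => β j) ?_).trans_eq ?_
  · refine le_trans ?_ hβ
    rw [sum_coe_sort (trueSupport β) (fun j => β j ^ 2)]
    exact sum_le_sum_of_subset_of_nonneg (subset_univ _) fun _ _ _ => sq_nonneg _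
  · have := mulVec_eq_add X β (trueSupport β)
    rw [rss_eq]
    have h0 : colBlock X (trueSupport β \ trueSupport β) *ᵥ (fun j => β j) = 0 := by
      ext i
      simp only [mulVec, dotProduct, Pi.zero_apply]
      exact sum_eq_zero fun j _ => absurd j.2 (by simp)
    rw [h0, zero_add] at this
    simp only [linearData]
    rw [this, add_sub_cancel_left]

/-- If every support of size `s` other than `T` exceeds the objective of `T` by more than `δ ≥ 0`,
then `T` comes first, and the gap to the second support exceeds `δ`. -/
lemma IsTopTwo.lt_sub {n p s : ℕ} {r δ : ℝ} {D : Dataset n p} {S₁ S₂ T : Finset (Fin p)}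
    (h : IsTopTwo r s D S₁ S₂) (hT : T.card = s) (hδ : 0 ≤ δ)
    (hgap : ∀ S : Finset (Fin p), S.card = s → S ≠ T → δ < objective r S D - objective r T D) :
    δ < objective r S₂ D - objective r S₁ D := by
  obtain ⟨⟨h1, h1min⟩, h2, hne, -⟩ := h
  have hST : S₁ = T := by
    by_contra hc
    linarith [hgap S₁ h1 hc, h1min T hT]
  subst hST
  exact hgap S₂ h2 hne

/-! ### Concentration of linear forms of the noise -/

/-- Chernoff bound for a linear form of independent sub-Gaussian variables; `V > 0` is any upper
bound for the squared norm of the weights, so that vanishing weights are allowed. -/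
lemma measureReal_le_sum_mul {n : ℕ} {Ω : Type*} [MeasurableSpace Ω] {μ : Measure Ω}
    [IsProbabilityMeasure μ] {ε : Fin n → Ω → ℝ} {σ : NNReal}
    (hind : iIndepFun ε μ)
    (hsub : ∀ i, HasSubgaussianMGF (ε i) (σ ^ 2) μ) {w : Fin n → ℝ} {V t : ℝ} (hV : 0 < V)
    (hw : w ⬝ᵥ w ≤ V) (ht : 0 ≤ t) :
    μ.real {ω | t ≤ ∑ i, w i * ε i ω} ≤ Real.exp (-t ^ 2 / (2 * (V * σ ^ 2))) := by
  have hind' : iIndepFun (fun i ω => w i * ε i ω) μ :=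
    hind.comp (fun i x => w i * x) fun i => measurable_const_mul _
  have hi (i : Fin n) :
      HasSubgaussianMGF (fun ω => w i * ε i ω) ((w i ^ 2).toNNReal * σ ^ 2) μ := by
    rw [Real.toNNReal_of_nonneg (sq_nonneg (w i))]
    exact (hsub i).const_mul (w i)
  have hs := HasSubgaussianMGF.sum_of_iIndepFun hind' (s := univ) fun i _ => hi i
  have hs' : HasSubgaussianMGF (fun ω => ∑ i, w i * ε i ω) (V.toNNReal * σ ^ 2) μ := by
    refine ⟨hs.integrable_exp_mul, fun s => (hs.mgf_le s).trans (Real.exp_le_exp.2 ?_)⟩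
    have : ∑ i, (w i ^ 2).toNNReal * σ ^ 2 ≤ V.toNNReal * σ ^ 2 := by
      rw [← sum_mul, ← Real.toNNReal_sum_of_nonneg fun i _ => sq_nonneg (w i)]
      refine mul_le_mul_of_nonneg_right (Real.toNNReal_le_toNNReal ?_) zero_le
      simpa [dotProduct, sq] using hw
    have : ((∑ i, (w i ^ 2).toNNReal * σ ^ 2 : NNReal) : ℝ) ≤
        ((V.toNNReal * σ ^ 2 : NNReal) : ℝ) := by exact_mod_cast this
    gcongr
  have := hs'.measure_ge_le ht
  simpa [Real.coe_toNNReal _ hV.le] using this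

lemma exp_neg_mul_log {p : ℕ} (hp : 0 < p) (k : ℕ) :
    Real.exp (-(k * Real.log p)) = ((p : ℝ) ^ k)⁻¹ := by
  rw [Real.exp_neg, Real.exp_nat_mul, Real.exp_log (by exact_mod_cast hp)]

/-- All columns of the design have small correlation with the noise, with high probability. -/
lemma measureReal_iUnion_column_le {n p : ℕ} (hn : 0 < n) (hp : 0 < p) {Ω : Type*}
    [MeasurableSpace Ω] {μ : Measure Ω} [IsProbabilityMeasure μ] {ε : Fin n → Ω → ℝ} {σ : NNReal}
    (hσ : 0 < σ) (hind : iIndepFun ε μ) (hsub : ∀ i, HasSubgaussianMGF (ε i) (σ ^ 2) μ)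
    {X : Matrix (Fin n) (Fin p) ℝ} {b : ℝ} (hb : 0 < b) (hX : ∀ i j, |X i j| ≤ b) :
    μ.real (⋃ j, {ω | 4 * σ * b * √(n * Real.log p) ≤ |∑ i, X i j * ε i ω|}) ≤
      2 * p * ((p : ℝ) ^ 8)⁻¹ := by
  have hn' : (0 : ℝ) < n := by exact_mod_cast hn
  have hσ' : (0 : ℝ) < σ := hσ
  have hlog : 0 ≤ Real.log p := Real.log_natCast_nonneg p
  set m : ℝ := 4 * σ * b * √(n * Real.log p)
  have hm : 0 ≤ m := by positivity
  have hexp : -m ^ 2 / (2 * (n * b ^ 2 * σ ^ 2)) = -((8 : ℕ) * Real.log p) := by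
    have : m ^ 2 = 16 * σ ^ 2 * b ^ 2 * (n * Real.log p) := by
      simp only [m, mul_pow]
      rw [Real.sq_sqrt (by positivity)]
      ring
    rw [this]
    push_cast
    field_simp
    ring
  have hone (w : Fin n → ℝ) (hw : ∀ i, |w i| ≤ b) :
      μ.real {ω | m ≤ ∑ i, w i * ε i ω} ≤ ((p : ℝ) ^ 8)⁻¹ := by
    refine (measureReal_le_sum_mul hind hsub (V := n * b ^ 2) (by positivity) ?_ hm).trans_eq ?_
    · calc w ⬝ᵥ w = ∑ i, w i ^ 2 := by simp [dotProduct, sq]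
        _ ≤ ∑ _i : Fin n, b ^ 2 := sum_le_sum fun i _ => sq_le_sq' (abs_le.1 (hw i)).1
              (abs_le.1 (hw i)).2
        _ = n * b ^ 2 := by simp
    · rw [hexp, exp_neg_mul_log hp]
  have hcol (j : Fin p) :
      μ.real {ω | m ≤ |∑ i, X i j * ε i ω|} ≤ 2 * ((p : ℝ) ^ 8)⁻¹ := by
    have hsplit : {ω | m ≤ |∑ i, X i j * ε i ω|} ⊆
        {ω | m ≤ ∑ i, X i j * ε i ω} ∪ {ω | m ≤ ∑ i, -X i j * ε i ω} := by
      intro ω hω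
      rcases le_abs.1 (Set.mem_ofPred.1 hω) with h | h
      · exact Or.inl h
      · exact Or.inr (by simpa using h)
    have h1 := hone (fun i => X i j) fun i => hX i j
    have h2 := hone (fun i => -X i j) fun i => by rw [abs_neg]; exact hX i j
    linarith [measureReal_mono (μ := μ) hsplit,
      measureReal_union_le (μ := μ) {ω | m ≤ ∑ i, X i j * ε i ω} {ω | m ≤ ∑ i, -X i j * ε i ω}]
  calc _ ≤ ∑ j, μ.real {ω | m ≤ |∑ i, X i j * ε i ω|} := measureReal_iUnion_fintype_le _
    _ ≤ ∑ _j : Fin p, 2 * ((p : ℝ) ^ 8)⁻¹ := sum_le_sum fun j _ => hcol j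
    _ = _ := by simp; ring

/-- The cross terms of the noise with a family of vectors indexed by the supports of size `s` are
small, with high probability. The deviation `√(6 s log p)` beats the at most `p ^ s` supports. -/
lemma measureReal_iUnion_support_le {n p s : ℕ} (hs : 1 ≤ s) (hp : 0 < p) {Ω : Type*}
    [MeasurableSpace Ω] {μ : Measure Ω} [IsProbabilityMeasure μ] {ε : Fin n → Ω → ℝ} {σ : NNReal}
    (hσ : 0 < σ) (hind : iIndepFun ε μ) (hsub : ∀ i, HasSubgaussianMGF (ε i) (σ ^ 2) μ)
    (T : Finset (Fin p)) (u : Finset (Fin p) → Fin n → ℝ)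
    (hu : ∀ S : Finset (Fin p), S.card = s → S ≠ T → 0 < u S ⬝ᵥ u S) :
    μ.real (⋃ S ∈ (powersetCard s univ).erase T,
        {ω | √(6 * (u S ⬝ᵥ u S) * σ ^ 2 * (s * Real.log p)) ≤ -∑ i, u S i * ε i ω}) ≤
      ((p : ℝ) ^ 2)⁻¹ := by
  have hσ' : (0 : ℝ) < σ := hσ
  have hp' : (1 : ℝ) ≤ p := by exact_mod_cast hp
  have hlog : 0 ≤ Real.log p := Real.log_natCast_nonneg p
  have hone : ∀ S ∈ (powersetCard s univ).erase T,
      μ.real {ω | √(6 * (u S ⬝ᵥ u S) * σ ^ 2 * (s * Real.log p)) ≤ -∑ i, u S i * ε i ω} ≤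
        ((p : ℝ) ^ (3 * s))⁻¹ := by
    intro S hS
    rw [mem_erase, mem_powersetCard] at hS
    have hU := hu S hS.2.2 hS.1
    have h := measureReal_le_sum_mul hind hsub (w := -u S) (V := u S ⬝ᵥ u S) hU (by simp)
      (Real.sqrt_nonneg (6 * (u S ⬝ᵥ u S) * σ ^ 2 * (s * Real.log p)))
    have hexp : -√(6 * (u S ⬝ᵥ u S) * σ ^ 2 * (s * Real.log p)) ^ 2 /
        (2 * (u S ⬝ᵥ u S * σ ^ 2)) = -((3 * s : ℕ) * Real.log p) := by
      rw [Real.sq_sqrt (by positivity)]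
      push_cast
      field_simp
      ring
    rw [hexp, exp_neg_mul_log hp] at h
    simpa using h
  have hcard : (((powersetCard s univ).erase T).card : ℝ) ≤ (p : ℝ) ^ s := by
    have h1 : ((powersetCard s (univ : Finset (Fin p))).erase T).card ≤ p ^ s :=
      (card_erase_le.trans_eq (by simp)).trans (Nat.choose_le_pow p s)
    exact_mod_cast h1
  calc _ ≤ ∑ S ∈ (powersetCard s univ).erase T, μ.real
        {ω | √(6 * (u S ⬝ᵥ u S) * σ ^ 2 * (s * Real.log p)) ≤ -∑ i, u S i * ε i ω} :=
        measureReal_biUnion_finset_le _ _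
    _ ≤ ((powersetCard s univ).erase T).card * ((p : ℝ) ^ (3 * s))⁻¹ := by
        simpa using sum_le_sum hone
    _ ≤ (p : ℝ) ^ s * ((p : ℝ) ^ (3 * s))⁻¹ := by gcongr
    _ = ((p : ℝ) ^ (2 * s))⁻¹ := by
        rw [show 3 * s = s + 2 * s by ring, pow_add]
        field_simp
    _ ≤ ((p : ℝ) ^ 2)⁻¹ := by
        refine inv_anti₀ (by positivity) (pow_le_pow_right₀ hp' ?_)
        omega

/-! ### The gap between the objectives -/

/-- The noiseless residual dominates the cross term, the noise fitted by the wrong support and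
the sensitivity bound. -/
lemma gap_of_residual {U x f L A c₀ σ s yb bx r : ℝ} (hc : c₀ = 4 + yb ^ 2 + bx ^ 2 * r ^ 2)
    (hU1 : 64 * c₀ * σ ^ 2 * L ≤ U) (hU2 : 64 * c₀ * L ≤ U) (hsL : s ≤ L) (hs : 1 ≤ s)
    (hx : -x < √(6 * U * σ ^ 2 * L)) (hf : f ≤ bx ^ 2 * r ^ 2 * L)
    (hA : A = 2 * (2 * yb ^ 2 + 2 * bx ^ 2 * r ^ 2 * s)) :
    A < U + 2 * x - f := by
  have hL : 1 ≤ L := hs.trans hsL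
  have hL0 : 0 ≤ L := zero_le_one.trans hL
  have hb : 0 ≤ yb ^ 2 := sq_nonneg _
  have hr : 0 ≤ bx ^ 2 * r ^ 2 := by positivity
  have hc4 : 4 ≤ c₀ := by linarith
  have hU0 : 0 ≤ U := le_trans (by positivity) hU2
  have hsq : √(6 * U * σ ^ 2 * L) ≤ U / 4 := by
    refine Real.sqrt_le_iff.2 ⟨by positivity, ?_⟩
    have : 64 * 4 * σ ^ 2 * L ≤ U := le_trans (by gcongr) hU1
    nlinarith [mul_le_mul_of_nonneg_left this hU0, mul_nonneg hU0 hU0]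
  have h1 : yb ^ 2 ≤ yb ^ 2 * L := le_mul_of_one_le_right hb hL
  have h2 : bx ^ 2 * r ^ 2 * s ≤ bx ^ 2 * r ^ 2 * L := mul_le_mul_of_nonneg_left hsL hr
  have h3 : c₀ * L = 4 * L + yb ^ 2 * L + bx ^ 2 * r ^ 2 * L := by rw [hc]; ring
  have h4 : 0 ≤ bx ^ 2 * r ^ 2 * L := mul_nonneg hr hL0
  have h5 : 0 ≤ yb ^ 2 * L := mul_nonneg hb hL0
  linarith

/-- On the event that the noise has small correlations with all columns and with the noiseless
residual of `S`, the objective of the wrong support `S` exceeds that of the true one. -/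
lemma lt_objective_sub {n p s : ℕ} (hn : 0 < n) (hs : 1 ≤ s) {X : Matrix (Fin n) (Fin p) ℝ}
    {β : Fin p → ℝ} {e : Fin n → ℝ} {S : Finset (Fin p)} (hS : S.card = s)
    {κm κp σ bx yb r c₀ : ℝ} (hκ : 0 < κm) (hσ : 0 < σ) (hbx : 0 < bx)
    (hX : ∀ i j, |X i j| ≤ bx) (h : spectrum ℝ (covBlock X S S) ⊆ Set.Icc κm κp)
    (hr : 4 * (σ * bx / κm) ≤ r) (hβ : ∑ j, β j ^ 2 ≤ r ^ 2)
    (hp : 1 ≤ Real.log p) {a : S → ℝ} {u : Fin n → ℝ}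
    (hdec : X *ᵥ β = colBlock X S *ᵥ a + u) (horth : (colBlock X S)ᵀ *ᵥ u = 0)
    (hc : c₀ = 4 + yb ^ 2 + bx ^ 2 * r ^ 2)
    (hu1 : 64 * c₀ * σ ^ 2 * (s * Real.log p) ≤ u ⬝ᵥ u)
    (hu2 : 64 * c₀ * (s * Real.log p) ≤ u ⬝ᵥ u)
    (hcol : ∀ j, |∑ i, X i j * e i| ≤ 4 * σ * bx * √(n * Real.log p))
    (hcross : -(u ⬝ᵥ e) < √(6 * (u ⬝ᵥ u) * σ ^ 2 * (s * Real.log p))) :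
    2 * (2 * yb ^ 2 + 2 * bx ^ 2 * r ^ 2 * s) <
      objective r S (linearData X β e) - objective r (trueSupport β) (linearData X β e) := by
  have hn' : (0 : ℝ) < n := by exact_mod_cast hn
  have hs' : (1 : ℝ) ≤ s := by exact_mod_cast hs
  have hlow := le_objective (r := r) (linearData X β e) S fun b _ =>
    le_rss_linearData hn hκ h hdec horth hcol b
  have hup := objective_trueSupport_le X e hβ
  have hSne : S.Nonempty := card_pos.1 (by omega)
  have hκb := le_sq_of_spectrum hn hX hSne h
  -- `16 σ² b_x² / κ₋ ≤ b_x² r²`, because `r ≥ 4 σ b_x / κ₋` and `κ₋ ≤ b_x²`.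
  have hfit : S.card * (4 * σ * bx * √(n * Real.log p)) ^ 2 / (n * κm) ≤
      bx ^ 2 * r ^ 2 * (s * Real.log p) := by
    have e1 : S.card * (4 * σ * bx * √(n * Real.log p)) ^ 2 / (n * κm) =
        16 * σ ^ 2 * bx ^ 2 / κm * (s * Real.log p) := by
      rw [hS, mul_pow, Real.sq_sqrt (by positivity)]
      field_simp
      norm_num
    rw [e1]
    refine mul_le_mul_of_nonneg_right ?_ (by positivity)
    calc 16 * σ ^ 2 * bx ^ 2 / κm = κm * (4 * (σ * bx / κm)) ^ 2 := by field_simp; norm_num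
      _ ≤ bx ^ 2 * r ^ 2 := by gcongr
  have := gap_of_residual (s := s) hc hu1 hu2 (le_mul_of_one_le_right (by positivity) hp) hs'
    hcross hfit rfl
  linarith

lemma one_sub_le_measureReal {Ω : Type*} [MeasurableSpace Ω] {μ : Measure Ω}
    [IsProbabilityMeasure μ] {A B : Set Ω} {b : ℝ} (hB : μ.real B ≤ b) (h : Bᶜ ⊆ A) :
    1 - b ≤ μ.real A := by
  have hun : B ∪ A = Set.univ := by
    rw [Set.eq_univ_iff_forall]
    intro ω
    by_cases hω : ω ∈ B
    · exact Or.inl hω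
    · exact Or.inr (h hω)
  have := measureReal_union_le (μ := μ) B A
  rw [hun, probReal_univ] at this
  linarith

end BSS

theorem lemmaA :
    ∃ c : ℝ, 0 < c ∧
      ∀ (n p s : ℕ) (_ : 1 ≤ s) (_ : s < p)
        -- the data space and its bounds
        (𝒳 : Set (Fin p → ℝ)) (𝒴 : Set ℝ) (b_x b_y : ℝ) (_ : 0 < b_x) (_ : 0 < b_y)
        (_ : ∀ x ∈ 𝒳, ∀ j, |x j| ≤ b_x) (_ : ∀ v ∈ 𝒴, |v| ≤ b_y)
        -- the linear model: fixed design, `s`-sparse coefficients, i.i.d. sub-Gaussian noise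
        (X : Matrix (Fin n) (Fin p) ℝ) (_ : ∀ i, X i ∈ 𝒳)
        (β : Fin p → ℝ) (_ : (BSS.trueSupport β).card = s)
        (Ω : Type*) (_ : MeasurableSpace Ω) (μ : Measure Ω) (_ : IsProbabilityMeasure μ)
        (ε : Fin n → Ω → ℝ) (σ : NNReal) (_ : 0 < σ)
        (_ : ∀ i, Measurable (ε i)) (_ : iIndepFun ε μ)
        (_ : ∀ i k, IdentDistrib (ε i) (ε k) μ μ)
        (_ : ∀ i, ∫ ω, ε i ω ∂μ = 0) (_ : ∀ i, HasSubgaussianMGF (ε i) (σ ^ 2) μ)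
        (_ : ∀ i, ∀ᵐ ω ∂μ, (BSS.linearData X β (fun k => ε k ω)).y i ∈ 𝒴)
        -- boundedness of the coefficients
        (M : ℝ) (_ : 0 < M) (_ : Real.sqrt (∑ j, β j ^ 2) ≤ M)
        -- sparse Riesz condition
        (κm κp : ℝ) (_ : 0 < κm) (_ : 0 < κp) (_ : BSS.SparseRiesz X s κm κp)
        -- sparsity
        (_ : (s : ℝ) ≤ n / Real.log p) (_ : 3 ≤ p)
        -- the radius of the constraint
        (r : ℝ) (_ : κp / κm * M + 4 * (σ * b_x / κm) ≤ r)
        -- the first two enumerated supports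
        (S₁ S₂ : BSS.Dataset n p → Finset (Fin p))
        (_ : ∀ D, BSS.IsTopTwo r s D (S₁ D) (S₂ D))
        -- the constants
        (c₀ C : ℝ) (_ : c₀ = 4 / c + b_y ^ 2 + b_x ^ 2 * r ^ 2)
        (_ : C = max (8 ^ 2 * c₀) (8 ^ 2 * c₀ / (σ : ℝ) ^ 2))
        (_ : C * (σ : ℝ) ^ 2 * (s * Real.log p / n) ≤ BSS.identMargin X β s),
        -- the global sensitivity is finite, and the gap exceeds twice the global sensitivity,
        -- and even twice its explicit upper bound
        BddAbove (BSS.sensitivitySet n s r 𝒳 𝒴) ∧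
        1 - 10 * s * ((p : ℝ) ^ 2)⁻¹ ≤
          μ.real {ω | 2 * BSS.globalSensitivity n s r 𝒳 𝒴 <
            BSS.objective r (S₂ (BSS.linearData X β (fun i => ε i ω)))
                (BSS.linearData X β (fun i => ε i ω)) -
              BSS.objective r (S₁ (BSS.linearData X β (fun i => ε i ω)))
                (BSS.linearData X β (fun i => ε i ω))} ∧
        1 - 10 * s * ((p : ℝ) ^ 2)⁻¹ ≤
          μ.real {ω | 2 * (2 * b_y ^ 2 + 2 * b_x ^ 2 * r ^ 2 * s) <
            BSS.objective r (S₂ (BSS.linearData X β (fun i => ε i ω)))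
                (BSS.linearData X β (fun i => ε i ω)) -
              BSS.objective r (S₁ (BSS.linearData X β (fun i => ε i ω)))
                (BSS.linearData X β (fun i => ε i ω))} := by
  classical
  refine ⟨1, one_pos, ?_⟩
  intro n p s hs hsp 𝒳 𝒴 bx yb hbx hyb h𝒳 h𝒴 X hX β hβ Ω _ μ _ ε σ hσ _ hind _ _ hsub _ M hM hβM
    κm κp hκm hκp hriesz hspars hp r hr S₁ S₂ htop c₀ C hc₀ hC hτ
  have hp0 : 0 < p := by omega
  have hp3 : (3 : ℝ) ≤ p := by exact_mod_cast hp
  have hs' : (1 : ℝ) ≤ s := by exact_mod_cast hs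
  have hσ' : (0 : ℝ) < σ := hσ
  have hlog : 1 ≤ Real.log p := by
    rw [Real.le_log_iff_exp_le (by positivity)]
    linarith [Real.exp_one_lt_d9]
  have hn : 0 < n := by
    rcases Nat.eq_zero_or_pos n with rfl | h
    · simp at hspars
      linarith
    · exact h
  have hn' : (0 : ℝ) < n := by exact_mod_cast hn
  have hXb : ∀ i j, |X i j| ≤ bx := fun i => h𝒳 _ (hX i)
  rw [div_one] at hc₀
  have hc₀pos : 0 < c₀ := by rw [hc₀]; positivity
  -- The true coefficients are feasible for the constrained least squares problem.
  have hTne : (BSS.trueSupport β).Nonempty := Finset.card_pos.1 (by omega)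
  have hκ : κm ≤ κp := BSS.le_of_spectrum hTne (hriesz _ hβ)
  have hMr : M ≤ r := by
    have h1 : 1 ≤ κp / κm := (one_le_div hκm).2 hκ
    have h2 : M ≤ κp / κm * M := le_mul_of_one_le_left hM.le h1
    have h3 : 0 ≤ 4 * (σ * bx / κm) := by positivity
    linarith
  have hr4 : 4 * (σ * bx / κm) ≤ r := by
    have : 0 ≤ κp / κm * M := by positivity
    linarith
  have hβr : ∑ j, β j ^ 2 ≤ r ^ 2 :=
    (Real.sqrt_le_left (hM.le.trans hMr)).1 (hβM.trans hMr)
  -- The noiseless residuals of the wrong supports.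
  have hres : ∀ S : Finset (Fin p), ∃ u : Fin n → ℝ, S.card = s → S ≠ BSS.trueSupport β →
      (∃ a, X.mulVec β = (BSS.colBlock X S).mulVec a + u) ∧
      (BSS.colBlock X S).transpose.mulVec u = 0 ∧
      64 * c₀ * σ ^ 2 * (s * Real.log p) ≤ dotProduct u u ∧
      64 * c₀ * (s * Real.log p) ≤ dotProduct u u := by
    intro S
    by_cases hS : S.card = s ∧ S ≠ BSS.trueSupport β
    · have hunit : IsUnit (BSS.covBlock X S S).det := by
        rw [← Matrix.isUnit_iff_isUnit_det, ← spectrum.zero_notMem_iff ℝ]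
        exact fun h0 => hκm.not_ge (hriesz S hS.1 h0).1
      obtain ⟨a, u, hdec, horth, hnorm⟩ := BSS.exists_residual hn X β hunit
      refine ⟨u, fun _ _ => ⟨⟨a, hdec⟩, horth, ?_⟩⟩
      have hcard : (1 : ℝ) ≤ (BSS.trueSupport β \ S).card := by
        have : 0 < (BSS.trueSupport β \ S).card := by
          rw [Finset.card_pos, Finset.sdiff_nonempty]
          exact fun h => hS.2 (Finset.eq_of_subset_of_card_le h (hS.1.trans hβ.symm).le).symm
        exact_mod_cast this
      have hCσ : 64 * c₀ * σ ^ 2 ≤ C * σ ^ 2 ∧ 64 * c₀ ≤ C * σ ^ 2 := by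
        constructor
        · refine mul_le_mul_of_nonneg_right ?_ (by positivity)
          rw [hC]
          exact le_trans (by norm_num) (le_max_left _ _)
        · rw [← div_le_iff₀ (by positivity), hC]
          exact le_trans (by norm_num) (le_max_right _ _)
      have hCpos : 0 < C * (σ : ℝ) ^ 2 := lt_of_lt_of_le (by positivity) hCσ.2
      have hlow : C * σ ^ 2 * (s * Real.log p) ≤ dotProduct u u := by
        have hmar := hτ.trans (BSS.identMargin_le_margin X hS.1 hβ hS.2)
        have hmar0 : 0 ≤ BSS.margin X β S := le_trans (by positivity) hmar
        rw [hnorm]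
        calc C * σ ^ 2 * (s * Real.log p) = n * (C * σ ^ 2 * (s * Real.log p / n)) := by
              field_simp
          _ ≤ n * (BSS.margin X β S * (BSS.trueSupport β \ S).card) := by
              exact mul_le_mul_of_nonneg_left
                (hmar.trans (le_mul_of_one_le_right hmar0 hcard)) hn'.le
      have hL : 0 ≤ s * Real.log p := by positivity
      exact ⟨(mul_le_mul_of_nonneg_right hCσ.1 hL).trans hlow,
        (mul_le_mul_of_nonneg_right hCσ.2 hL).trans hlow⟩
    · exact ⟨0, fun h1 h2 => absurd ⟨h1, h2⟩ hS⟩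
  choose u hu using hres
  -- The exceptional event.
  set B₁ : Set Ω := ⋃ j, {ω | 4 * σ * bx * √(n * Real.log p) ≤ |∑ i, X i j * ε i ω|} with hB₁
  set B₂ : Set Ω := ⋃ S ∈ (Finset.powersetCard s Finset.univ).erase (BSS.trueSupport β),
    {ω | √(6 * (dotProduct (u S) (u S)) * σ ^ 2 * (s * Real.log p)) ≤ -∑ i, u S i * ε i ω} with hB₂
  have hbad : μ.real (B₁ ∪ B₂) ≤ 10 * s * ((p : ℝ) ^ 2)⁻¹ := by
    have h1 := BSS.measureReal_iUnion_column_le hn hp0 hσ hind hsub hbx hXb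
    have h2 := BSS.measureReal_iUnion_support_le hs hp0 hσ hind hsub (BSS.trueSupport β) u
      fun S hS hne => lt_of_lt_of_le (by positivity) (hu S hS hne).2.2.2
    have h3 : (p : ℝ) * ((p : ℝ) ^ 8)⁻¹ ≤ ((p : ℝ) ^ 2)⁻¹ := by
      have : (p : ℝ) * ((p : ℝ) ^ 8)⁻¹ = ((p : ℝ) ^ 7)⁻¹ := by field_simp
      rw [this]
      gcongr
      · linarith
      · norm_num
    have h4 : (0 : ℝ) ≤ ((p : ℝ) ^ 2)⁻¹ := by positivity
    nlinarith [measureReal_union_le (μ := μ) B₁ B₂]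
  set A : Set Ω := {ω | 2 * (2 * yb ^ 2 + 2 * bx ^ 2 * r ^ 2 * s) <
    BSS.objective r (S₂ (BSS.linearData X β (fun i => ε i ω)))
        (BSS.linearData X β (fun i => ε i ω)) -
      BSS.objective r (S₁ (BSS.linearData X β (fun i => ε i ω)))
        (BSS.linearData X β (fun i => ε i ω))} with hA
  have hsubset : (B₁ ∪ B₂)ᶜ ⊆ A := by
    intro ω hω
    rw [Set.compl_union] at hω
    obtain ⟨hω1, hω2⟩ := hω
    simp only [hB₁, hB₂, Set.mem_compl_iff, Set.mem_iUnion, Set.mem_ofPred_eq, not_exists,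
      not_le, Finset.mem_erase, Finset.mem_powersetCard] at hω1 hω2
    refine (htop _).lt_sub hβ (by positivity) fun S hS hne => ?_
    obtain ⟨⟨a, hdec⟩, horth, hu1, hu2⟩ := hu S hS hne
    exact BSS.lt_objective_sub hn hs hS hκm hσ' hbx hXb (hriesz S hS) hr4 hβr hlog hdec horth
      hc₀ hu1 hu2 (fun j => (hω1 j).le) (hω2 S ⟨hne, Finset.subset_univ _, hS⟩)
  have hΔ : ∀ d ∈ BSS.sensitivitySet n s r 𝒳 𝒴, d ≤ 2 * yb ^ 2 + 2 * bx ^ 2 * r ^ 2 * s :=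
    fun d hd => BSS.le_of_mem_sensitivitySet h𝒳 h𝒴 hd
  have hΔ' : BSS.globalSensitivity n s r 𝒳 𝒴 ≤ 2 * yb ^ 2 + 2 * bx ^ 2 * r ^ 2 * s :=
    Real.sSup_le hΔ (by positivity)
  refine ⟨⟨_, hΔ⟩, BSS.one_sub_le_measureReal hbad (hsubset.trans fun ω hω => ?_),
    BSS.one_sub_le_measureReal hbad hsubset⟩
  exact lt_of_le_of_lt (mul_le_mul_of_nonneg_left hΔ' two_pos.le) hω
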